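/- \textbf{Definitions.} The \emph{elementary functions} $\mathbb N^n\to\mathbb N$ are those generated from the initial functions $0$, $S(x)=x+1$, the projections, $2^x$ and $\max$ by composition and bounded primitive recursion (primitive recursion in which the defined function is bounded by an already generated function). A relation is elementary if its characteristic function is. A function $F:\mathbb N\to\mathbb Q$ is elementary if $n\mapsto \langle F(n)\rangle$ is elementary, where rationals are coded by natural numbers through a fixed standard coding (the pair of numerator and denominator of the reduced form). A function $f:\mathbb N\to\mathbb N$ is \emph{honest} if $f(x)\le f(x+1)$ and $f(x)\ge 2^x$ for all $x$, and the relation $f(x)=y$ is elementary. Let $P_0=2,P_1=3,\ldots$ be the primes in increasing order, let $g(0)=1$ and $g(j+1)=P_j^{\,2(j+2)(g(j)+1)^3}$, and for an honest function $f$ let $h(i)=g(f(i)+i)$ and $$\alpha^f=\lim_{n\to\infty}\alpha^f_n,\qquad \alpha^f_n=\sum_{i=0}^{n}P_i^{-h(i)} .$$ For an integer $b\ge 2$ and a real number $\alpha$, a function $A:\mathbb N\to\mathbb Q$ is a \emph{base-$b$ sum approximation from below of $\alpha$} if $A(0)=0$ and there are digits $\mathtt D_i\in\{1,\ldots,b-1\}$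 and positions $1\le k_1<k_2<\cdots$ such that $A(i)=\mathtt D_i b^{-k_i}$ for all $i\ge 1$ and $\alpha=\sum_{i=1}^{\infty}\mathtt D_i b^{-k_i}$. \textbf{Theorem.} For every honest function $f$ and every base $b\ge 2$, the number $\alpha^f$ has exactly one base-$b$ sum approximation from below, denoted $\hat A^{\alpha^f}_b$, and the function $\hat A^{\alpha^f}_b:\mathbb N\to\mathbb Q$ is elementary. -/

import Mathlib

namespace SumApprox

/-- The elementary functions on the natural numbers: the least class of functions that contains
`0`, the successor, the projections, `2 ^ x` and `max`, and that is closed under composition and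
bounded primitive recursion. In `bddRec` the recursion variable is the first argument. -/
inductive Elementary : ∀ {n : ℕ}, ((Fin n → ℕ) → ℕ) → Prop
  | zero : Elementary (fun _ : Fin 0 → ℕ => 0)
  | succ : Elementary (fun v : Fin 1 → ℕ => v 0 + 1)
  | proj {n : ℕ} (i : Fin n) : Elementary (fun v : Fin n → ℕ => v i)
  | twoPow : Elementary (fun v : Fin 1 → ℕ => 2 ^ v 0)
  | max : Elementary (fun v : Fin 2 → ℕ => Max.max (v 0) (v 1))
  | comp {m n : ℕ} {φ : (Fin n → ℕ) → ℕ} {ψ : Fin n → (Fin m → ℕ) → ℕ}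
      (hφ : Elementary φ) (hψ : ∀ i, Elementary (ψ i)) :
      Elementary (fun v : Fin m → ℕ => φ (fun i => ψ i v))
  | bddRec {n : ℕ} {base : (Fin n → ℕ) → ℕ} {step : (Fin (n + 2) → ℕ) → ℕ}
      {bound φ : (Fin (n + 1) → ℕ) → ℕ}
      (hbase : Elementary base) (hstep : Elementary step) (hbound : Elementary bound)
      (h_zero : ∀ v, φ (Matrix.vecCons 0 v) = base v)
      (h_succ : ∀ y v, φ (Matrix.vecCons (y + 1) v) =
        step (Matrix.vecCons y (Matrix.vecCons (φ (Matrix.vecCons y v)) v)))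
      (h_le : ∀ v, φ v ≤ bound v) :
      Elementary φ

/-- The coding of the integers by natural numbers: `n ↦ 2n` for `n ≥ 0`, `-(n+1) ↦ 2n+1`. -/
def intCode : ℤ → ℕ
  | Int.ofNat n => 2 * n
  | Int.negSucc n => 2 * n + 1

/-- The coding of a rational number by the pair (numerator, denominator) of its reduced form. -/
def ratCode (q : ℚ) : ℕ := Nat.pair (intCode q.num) q.den

theorem intCode_injective : Function.Injective intCode := by
  rintro (a | a) (b | b) h <;> simp only [intCode] at h
  · congr 1; omega
  · omega
  · omega
  · congr 1; omega

theorem ratCode_injective : Function.Injective ratCode := by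
  intro p q h
  have h' := Nat.pair_eq_pair.mp h
  exact Rat.ext (intCode_injective h'.1) h'.2

/-- A function from the natural numbers to the rational numbers is elementary if it is so
through the coding of the rational numbers. -/
def ElementaryRat (F : ℕ → ℚ) : Prop :=
  Elementary (fun v : Fin 1 → ℕ => ratCode (F (v 0)))

open Classical in
/-- A binary relation is elementary if its characteristic function is. -/
def ElementaryRel (R : ℕ → ℕ → Prop) : Prop :=
  Elementary (fun v : Fin 2 → ℕ => if R (v 0) (v 1) then 1 else 0)

/-- Honest functions: monotonically increasing, dominating `2 ^ x`, with elementary graph. -/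
structure Honest (f : ℕ → ℕ) : Prop where
  mono : ∀ x, f x ≤ f (x + 1)
  two_pow_le : ∀ x, 2 ^ x ≤ f x
  graph : ElementaryRel (fun x y => f x = y)

/-- The `i`-th prime, `P 0 = 2`, `P 1 = 3`, .... -/
noncomputable def P (i : ℕ) : ℕ := Nat.nth Nat.Prime i

/-- `g 0 = 1` and `g (j + 1) = P_j ^ (2 (j + 2) (g j + 1) ^ 3)`. -/
noncomputable def g : ℕ → ℕ
  | 0 => 1
  | j + 1 => P j ^ (2 * (j + 2) * (g j + 1) ^ 3)

/-- `h i = g (f i + i)`. -/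
noncomputable def h (f : ℕ → ℕ) (i : ℕ) : ℕ := g (f i + i)

/-- The rational number `α_n = ∑_{i ≤ n} P_i ^ (-h i)`. -/
noncomputable def alphaPartial (f : ℕ → ℕ) (n : ℕ) : ℚ :=
  ∑ i ∈ Finset.range (n + 1), ((P i : ℚ) ^ h f i)⁻¹

/-- The real number `α = lim α_n`. -/
noncomputable def alpha (f : ℕ → ℕ) : ℝ :=
  Filter.limUnder Filter.atTop (fun n => (alphaPartial f n : ℝ))

theorem le_g (n : ℕ) : n ≤ g n := by
  induction n with
  | zero => exact Nat.zero_le _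
  | succ j ih =>
    have hP : 2 ≤ P j := (Nat.prime_nth_prime j).two_le
    have h1 : g j + 1 ≤ 2 * (j + 2) * (g j + 1) ^ 3 := by
      calc g j + 1 ≤ (g j + 1) ^ 3 := Nat.le_self_pow (by norm_num) _
        _ ≤ 2 * (j + 2) * (g j + 1) ^ 3 := Nat.le_mul_of_pos_left _ (by positivity)
    calc j + 1 ≤ 2 * (j + 2) * (g j + 1) ^ 3 := by omega
      _ ≤ 2 ^ (2 * (j + 2) * (g j + 1) ^ 3) := Nat.lt_two_pow_self.le
      _ ≤ g (j + 1) := Nat.pow_le_pow_left hP _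

/-- The limit that defines `alpha` exists. -/
theorem tendsto_alphaPartial (f : ℕ → ℕ) :
    Filter.Tendsto (fun n => (alphaPartial f n : ℝ)) Filter.atTop (nhds (alpha f)) := by
  have hs : Summable (fun i => ((P i : ℝ) ^ h f i)⁻¹) := by
    refine Summable.of_nonneg_of_le (fun i => by positivity) (fun i => ?_)
      (summable_geometric_of_lt_one (r := (1 / 2 : ℝ)) (by norm_num) (by norm_num))
    have hP : (2 : ℝ) ≤ P i := by exact_mod_cast (Nat.prime_nth_prime i).two_le
    have hi : i ≤ h f i := le_trans (Nat.le_add_left _ _) (le_g _)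
    rw [one_div, inv_pow]
    refine inv_anti₀ (by positivity) ?_
    calc (2 : ℝ) ^ i ≤ 2 ^ h f i := pow_le_pow_right₀ (by norm_num) hi
      _ ≤ (P i : ℝ) ^ h f i := pow_le_pow_left₀ (by norm_num) hP _
  refine tendsto_nhds_limUnder ⟨∑' i, ((P i : ℝ) ^ h f i)⁻¹, ?_⟩
  refine (hs.hasSum.tendsto_sum_nat.comp (Filter.tendsto_add_atTop_nat 1)).congr fun n => ?_
  simp [alphaPartial]

/-- `A` is the base-`b` sum approximation from below of `α`: `A 0 = 0`, and
`α = ∑_{i ≥ 1} D_i b ^ (-k_i)` with `A i = D_i b ^ (-k_i)`, nonzero base-`b` digits `D_i` and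
positions `1 ≤ k_1 < k_2 < ⋯`. -/
def IsSumApproxBelow (b : ℕ) (α : ℝ) (A : ℕ → ℚ) : Prop :=
  A 0 = 0 ∧
  ∃ D k : ℕ → ℕ,
    (∀ i, 1 ≤ i → 1 ≤ D i ∧ D i ≤ b - 1) ∧
    (∀ i, 1 ≤ i → 1 ≤ k i ∧ k i < k (i + 1)) ∧
    (∀ i, 1 ≤ i → A i = (D i : ℚ) / (b : ℚ) ^ k i) ∧
    HasSum (fun i => (A i : ℝ)) α

end SumApprox

/-!
Write `α` as the sum of the terms `P_j ^ (-h j)` and let `Q_n` be the product of the `P_j ^ h j`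
with `j < n`, a common denominator of the first `n` terms. The growth of `g` gives
`h (n + 1) ≥ 2 ^ (4 * h n ^ 3)`, while `Q_{n + 1} ≤ 2 ^ (h n ^ 3)`. Hence, whenever
`k * b + h n ^ 3 + 1 < h (n + 1)`, the terms of index greater than `n` are too small to change
`⌊b ^ k * α⌋`, which is the integer quotient of `b ^ k * N` by `Q_{n + 1}` with `N` the numerator
of the partial sum (`Honest.floor_pow_mul_alpha`). Two consequences carry the proof.

* The function `k ↦ ⌊b ^ k * α⌋` is elementary (`Honest.elementary_floor`). Although `f`, `g` and
  `h` need not be elementary, their truncations `min (h j) y` are, because the graph of `f` is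
  elementary and `g` can be computed by a recursion cut off at `y`; and only the terms with
  `h j ≤ 2 * (1 + k * b)` matter for `⌊b ^ k * α⌋`.

* The nonzero digits of `α` are not sparse (`Honest.digitPos_le`). If `P_n` does not divide `b`,
  the partial sum up to index `n` has no finite base-`b` expansion, so `b ^ k * α` exceeds its
  integer part by at least `1 / Q_{n + 1}`, and a nonzero digit occurs among the `h n ^ 3` digits
  after position `k` (`Honest.exists_digit_ne_zero`). This holds up to positions of order
  `h (n + 1)`, which is so much larger than `h n ^ 3` that by then the number `i` of nonzero digits
  satisfies `h (n + 1) ≤ (i * b + 2) ^ 2` (`Honest.h_succ_le_sq`). So the gap after the `i`-th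
  nonzero digit is always bounded by a polynomial in `i`, and so is its position.

An infinite elementary set whose enumeration has an elementary bound is enumerated by an elementary
function (`Elementary.nth`), so the positions of the nonzero digits, the digits, and the reduced
fractions `D_i / b ^ k_i` are elementary. Uniqueness holds for every real number
(`IsSumApproxBelow.unique`): what remains after the terms before the `i`-th lies in
`(D_i * b ^ (-k_i), (D_i + 1) * b ^ (-k_i)]`, and these intervals are disjoint for distinct pairs
of a position and a nonzero digit.
-/

namespace SumApprox

/-! ### Closure properties of the elementary functions -/

open Classical in
/-- A relation of any arity is elementary if its characteristic function is. -/
def ElementaryPred {n : ℕ} (p : (Fin n → ℕ) → Prop) : Prop :=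
  Elementary (fun v => if p v then 1 else 0)

theorem Elementary.of_eq {n : ℕ} {φ ψ : (Fin n → ℕ) → ℕ} (hφ : Elementary φ)
    (h : ∀ v, φ v = ψ v) : Elementary ψ := by
  rwa [← funext h]

theorem ElementaryPred.of_iff {n : ℕ} {p q : (Fin n → ℕ) → Prop} (hp : ElementaryPred p)
    (h : ∀ v, p v ↔ q v) : ElementaryPred q := by
  have : p = q := funext fun v => propext (h v)
  rwa [← this]

theorem Elementary.comp₁ {n : ℕ} {φ : ℕ → ℕ} (hφ : Elementary fun v : Fin 1 → ℕ => φ (v 0))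
    {a : (Fin n → ℕ) → ℕ} (ha : Elementary a) : Elementary fun v => φ (a v) :=
  hφ.comp (ψ := fun _ => a) fun _ => ha

theorem Elementary.comp₂ {n : ℕ} {φ : ℕ → ℕ → ℕ}
    (hφ : Elementary fun v : Fin 2 → ℕ => φ (v 0) (v 1)) {a b : (Fin n → ℕ) → ℕ}
    (ha : Elementary a) (hb : Elementary b) : Elementary fun v => φ (a v) (b v) :=
  hφ.comp (ψ := ![a, b]) (Fin.forall_fin_two.2 ⟨ha, hb⟩)

open Classical in
theorem ElementaryPred.comp₂ {n : ℕ} {p : ℕ → ℕ → Prop}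
    (hp : ElementaryPred fun v : Fin 2 → ℕ => p (v 0) (v 1)) {a b : (Fin n → ℕ) → ℕ}
    (ha : Elementary a) (hb : Elementary b) : ElementaryPred fun v => p (a v) (b v) :=
  Elementary.comp₂ (φ := fun x y => if p x y then 1 else 0) hp ha hb

theorem Elementary.const {n : ℕ} (c : ℕ) : Elementary fun _ : Fin n → ℕ => c := by
  induction c with
  | zero => exact Elementary.zero.comp (ψ := Fin.elim0) fun i => i.elim0
  | succ c ih => exact Elementary.comp₁ .succ ih

theorem Elementary.add_one {n : ℕ} {a : (Fin n → ℕ) → ℕ} (ha : Elementary a) :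
    Elementary fun v => a v + 1 :=
  Elementary.comp₁ (φ := fun x => x + 1) .succ ha

theorem Elementary.two_pow {n : ℕ} {a : (Fin n → ℕ) → ℕ} (ha : Elementary a) :
    Elementary fun v => 2 ^ a v :=
  Elementary.comp₁ (φ := fun x => 2 ^ x) .twoPow ha

theorem Elementary.sup {n : ℕ} {a b : (Fin n → ℕ) → ℕ} (ha : Elementary a)
    (hb : Elementary b) : Elementary fun v => Max.max (a v) (b v) :=
  Elementary.comp₂ .max ha hb

/-- Bounded primitive recursion in curried form, followed by substitution for the recursion
variable. -/
theorem Elementary.curryRec {n : ℕ} {F : ℕ → (Fin n → ℕ) → ℕ} {base : (Fin n → ℕ) → ℕ}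
    {step : ℕ → ℕ → (Fin n → ℕ) → ℕ} {bound : ℕ → (Fin n → ℕ) → ℕ} {t : (Fin n → ℕ) → ℕ}
    (ht : Elementary t) (hbase : Elementary base)
    (hstep : Elementary fun w : Fin (n + 2) → ℕ => step (w 0) (w 1) fun i => w i.succ.succ)
    (hbound : Elementary fun w : Fin (n + 1) → ℕ => bound (w 0) fun i => w i.succ)
    (h_zero : ∀ v, F 0 v = base v) (h_succ : ∀ y v, F (y + 1) v = step y (F y v) v)
    (h_le : ∀ y v, F y v ≤ bound y v) : Elementary fun v => F (t v) v := by
  have key : Elementary fun w : Fin (n + 1) → ℕ => F (w 0) fun i => w i.succ :=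
    Elementary.bddRec hbase hstep hbound (fun v => h_zero v) (fun y v => h_succ y v)
      (fun w => h_le _ _)
  exact key.comp (ψ := Fin.cons t fun i v => v i)
    (Fin.cases ht fun i => Elementary.proj i)

theorem Elementary.add {n : ℕ} {a b : (Fin n → ℕ) → ℕ} (ha : Elementary a)
    (hb : Elementary b) : Elementary fun v => a v + b v := by
  refine Elementary.comp₂ (φ := fun x y => x + y) ?_ ha hb
  refine Elementary.curryRec (F := fun y v => v 0 + y) (step := fun _ z _ => z + 1)
    (bound := fun y v => 2 ^ (Max.max (v 0) y + 1)) (.proj 1) (.proj 0) (.add_one (.proj 1))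
    (.two_pow (.add_one (.sup (.proj 1) (.proj 0)))) (fun _ => rfl) (fun _ _ => rfl) ?_
  intro y v
  have h1 := (Nat.lt_two_pow_self (n := Max.max (v 0) y))
  have h2 := le_max_left (v 0) y
  have h3 := le_max_right (v 0) y
  rw [pow_succ]
  omega

theorem Elementary.mul {n : ℕ} {a b : (Fin n → ℕ) → ℕ} (ha : Elementary a)
    (hb : Elementary b) : Elementary fun v => a v * b v := by
  refine Elementary.comp₂ (φ := fun x y => x * y) ?_ ha hb
  refine Elementary.curryRec (F := fun y v => v 0 * y) (step := fun _ z v => z + v 0)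
    (bound := fun y v => 2 ^ (v 0 + y)) (.proj 1) (.const 0) (.add (.proj 1) (.proj 2))
    (.two_pow (.add (.proj 1) (.proj 0))) (fun _ => rfl) (fun _ _ => rfl) ?_
  intro y v
  simp only [pow_add]
  exact Nat.mul_le_mul Nat.lt_two_pow_self.le Nat.lt_two_pow_self.le

theorem Elementary.pow {n : ℕ} {a b : (Fin n → ℕ) → ℕ} (ha : Elementary a)
    (hb : Elementary b) : Elementary fun v => a v ^ b v := by
  refine Elementary.comp₂ (φ := fun x y => x ^ y) ?_ ha hb
  refine Elementary.curryRec (F := fun y v => v 0 ^ y) (step := fun _ z v => z * v 0)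
    (bound := fun y v => 2 ^ (v 0 * y)) (.proj 1) (.const 1) (.mul (.proj 1) (.proj 2))
    (.two_pow (.mul (.proj 1) (.proj 0))) (fun _ => rfl) (fun _ _ => rfl) ?_
  intro y v
  simp only [pow_mul]
  exact Nat.pow_le_pow_left Nat.lt_two_pow_self.le _

theorem Elementary.pred {n : ℕ} {a : (Fin n → ℕ) → ℕ} (ha : Elementary a) :
    Elementary fun v => a v - 1 := by
  refine Elementary.comp₁ (φ := fun x => x - 1) ?_ ha
  exact Elementary.curryRec (F := fun y v => y - 1) (step := fun y _ _ => y)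
    (bound := fun y _ => y) (.proj 0) (.const 0) (.proj 0) (.proj 0) (fun _ => rfl)
    (fun _ _ => rfl) (fun y _ => Nat.sub_le y 1)

theorem Elementary.sub {n : ℕ} {a b : (Fin n → ℕ) → ℕ} (ha : Elementary a)
    (hb : Elementary b) : Elementary fun v => a v - b v := by
  refine Elementary.comp₂ (φ := fun x y => x - y) ?_ ha hb
  exact Elementary.curryRec (F := fun y v => v 0 - y) (step := fun _ z _ => z - 1)
    (bound := fun _ v => v 0) (.proj 1) (.proj 0) (.pred (.proj 1)) (.proj 1) (fun _ => rfl)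
    (fun _ _ => rfl) (fun y v => Nat.sub_le _ _)

theorem Elementary.inf {n : ℕ} {a b : (Fin n → ℕ) → ℕ} (ha : Elementary a)
    (hb : Elementary b) : Elementary fun v => Min.min (a v) (b v) :=
  (ha.sub (ha.sub hb)).of_eq fun v => by omega

theorem Elementary.ite {n : ℕ} {p : (Fin n → ℕ) → Prop} [DecidablePred p] {a b : (Fin n → ℕ) → ℕ}
    (hp : ElementaryPred p) (ha : Elementary a) (hb : Elementary b) :
    Elementary fun v => if p v then a v else b v :=
  ((hp.mul ha).add ((Elementary.sub (.const 1) hp).mul hb)).of_eq fun v => by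
    by_cases h : p v <;> simp [h]

theorem ElementaryPred.not {n : ℕ} {p : (Fin n → ℕ) → Prop} (hp : ElementaryPred p) :
    ElementaryPred fun v => ¬ p v :=
  (Elementary.sub (.const 1) hp).of_eq fun v => by by_cases h : p v <;> simp [h]

theorem ElementaryPred.and {n : ℕ} {p q : (Fin n → ℕ) → Prop} (hp : ElementaryPred p)
    (hq : ElementaryPred q) : ElementaryPred fun v => p v ∧ q v :=
  (Elementary.mul hp hq).of_eq fun v => by
    by_cases h : p v <;> by_cases h' : q v <;> simp [h, h']

theorem ElementaryPred.imp {n : ℕ} {p q : (Fin n → ℕ) → Prop} (hp : ElementaryPred p)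
    (hq : ElementaryPred q) : ElementaryPred fun v => p v → q v :=
  (hp.and hq.not).not.of_iff fun v => by tauto

theorem Elementary.le {n : ℕ} {a b : (Fin n → ℕ) → ℕ} (ha : Elementary a)
    (hb : Elementary b) : ElementaryPred fun v => a v ≤ b v :=
  (Elementary.sub (.const 1) (ha.sub hb)).of_eq fun v => by split_ifs <;> omega

theorem Elementary.eq {n : ℕ} {a b : (Fin n → ℕ) → ℕ} (ha : Elementary a)
    (hb : Elementary b) : ElementaryPred fun v => a v = b v :=
  ((ha.le hb).and (hb.le ha)).of_iff fun _ => le_antisymm_iff.symm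

theorem Elementary.findGreatest {n : ℕ} {p : ℕ → (Fin n → ℕ) → Prop}
    [∀ v, DecidablePred fun x => p x v] {t : (Fin n → ℕ) → ℕ}
    (hp : ElementaryPred fun w : Fin (n + 1) → ℕ => p (w 0) fun i => w i.succ)
    (ht : Elementary t) : Elementary fun v => Nat.findGreatest (fun x => p x v) (t v) := by
  classical
  refine Elementary.curryRec (F := fun y v => Nat.findGreatest (fun x => p x v) y)
    (step := fun y z v => if p (y + 1) v then y + 1 else z) (bound := fun y _ => y) ht
    (.const 0) ?_ (.proj 0) (fun _ => rfl) (fun y v => by rw [Nat.findGreatest_succ])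
    (fun y v => Nat.findGreatest_le y)
  refine Elementary.ite ?_ (.add_one (.proj 0)) (.proj 1)
  exact Elementary.comp hp (ψ := Fin.cons (fun w => w 0 + 1) fun i w => w i.succ.succ)
    (Fin.cases (.add_one (.proj 0)) fun i => Elementary.proj _)

theorem Elementary.count {n : ℕ} {p : ℕ → (Fin n → ℕ) → Prop}
    [∀ v, DecidablePred fun x => p x v] {t : (Fin n → ℕ) → ℕ}
    (hp : ElementaryPred fun w : Fin (n + 1) → ℕ => p (w 0) fun i => w i.succ)
    (ht : Elementary t) : Elementary fun v => Nat.count (fun x => p x v) (t v) := by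
  classical
  refine Elementary.curryRec (F := fun y v => Nat.count (fun x => p x v) y)
    (step := fun y z v => z + if p y v then 1 else 0) (bound := fun y _ => y) ht
    (.const 0) ?_ (.proj 0) (fun _ => rfl) (fun y v => by rw [Nat.count_succ])
    (fun y v => Nat.count_le _)
  refine Elementary.add (.proj 1) (Elementary.ite ?_ (.const 1) (.const 0))
  exact Elementary.comp hp (ψ := Fin.cons (fun w => w 0) fun i w => w i.succ.succ)
    (Fin.cases (.proj 0) fun i => Elementary.proj _)

theorem ElementaryPred.ball_lt {n : ℕ} {p : ℕ → (Fin n → ℕ) → Prop} {t : (Fin n → ℕ) → ℕ}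
    (hp : ElementaryPred fun w : Fin (n + 1) → ℕ => p (w 0) fun i => w i.succ)
    (ht : Elementary t) : ElementaryPred fun v => ∀ x < t v, p x v := by
  classical
  refine ((Elementary.count hp ht).eq ht).of_iff fun v => ?_
  exact Nat.count_iff_forall

/-- A bounded sum of elementary functions is elementary. The explicit bound on the partial sums
is the bound of the underlying recursion. -/
theorem Elementary.sum_range {n : ℕ} {φ B : ℕ → (Fin n → ℕ) → ℕ} {t : (Fin n → ℕ) → ℕ}
    (hφ : Elementary fun w : Fin (n + 1) → ℕ => φ (w 0) fun i => w i.succ)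
    (hB : Elementary fun w : Fin (n + 1) → ℕ => B (w 0) fun i => w i.succ)
    (h_le : ∀ y v, ∑ x ∈ Finset.range y, φ x v ≤ B y v) (ht : Elementary t) :
    Elementary fun v => ∑ x ∈ Finset.range (t v), φ x v := by
  refine Elementary.curryRec (F := fun y v => ∑ x ∈ Finset.range y, φ x v)
    (step := fun y z v => z + φ y v) (bound := B) ht (.const 0) ?_ hB (fun _ => rfl)
    (fun y v => Finset.sum_range_succ _ y) h_le
  refine Elementary.add (.proj 1) ?_
  exact Elementary.comp hφ (ψ := Fin.cons (fun w => w 0) fun i w => w i.succ.succ)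
    (Fin.cases (.proj 0) fun i => Elementary.proj _)

theorem Elementary.prod_range {n : ℕ} {φ B : ℕ → (Fin n → ℕ) → ℕ} {t : (Fin n → ℕ) → ℕ}
    (hφ : Elementary fun w : Fin (n + 1) → ℕ => φ (w 0) fun i => w i.succ)
    (hB : Elementary fun w : Fin (n + 1) → ℕ => B (w 0) fun i => w i.succ)
    (h_le : ∀ y v, ∏ x ∈ Finset.range y, φ x v ≤ B y v) (ht : Elementary t) :
    Elementary fun v => ∏ x ∈ Finset.range (t v), φ x v := by
  refine Elementary.curryRec (F := fun y v => ∏ x ∈ Finset.range y, φ x v)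
    (step := fun y z v => z * φ y v) (bound := B) ht (.const 1) ?_ hB (fun _ => rfl)
    (fun y v => Finset.prod_range_succ _ y) h_le
  refine Elementary.mul (.proj 1) ?_
  exact Elementary.comp hφ (ψ := Fin.cons (fun w => w 0) fun i w => w i.succ.succ)
    (Fin.cases (.proj 0) fun i => Elementary.proj _)

theorem Elementary.div {n : ℕ} {a b : (Fin n → ℕ) → ℕ} (ha : Elementary a)
    (hb : Elementary b) : Elementary fun v => a v / b v := by
  classical
  refine Elementary.comp₂ (φ := fun x y => x / y) ?_ ha hb
  refine (Elementary.findGreatest (p := fun q v => 0 < v 1 ∧ q * v 1 ≤ v 0) (t := fun v => v 0)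
    (.and (.le (.const 1) (.proj 2)) (.le (.mul (.proj 0) (.proj 2)) (.proj 1)))
    (.proj 0)).of_eq fun v => ?_
  rcases Nat.eq_zero_or_pos (v 1) with h | h
  · rw [Nat.findGreatest_eq_zero_iff.2]
    · simp [h]
    · intro q _ _ hq
      omega
  · rw [Nat.findGreatest_eq_iff]
    refine ⟨Nat.div_le_self _ _, fun _ => ⟨h, Nat.div_mul_le_self _ _⟩, fun q hq _ h' => ?_⟩
    exact absurd ((Nat.le_div_iff_mul_le h).2 h'.2) (by omega)

theorem Elementary.mod {n : ℕ} {a b : (Fin n → ℕ) → ℕ} (ha : Elementary a)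
    (hb : Elementary b) : Elementary fun v => a v % b v :=
  (ha.sub (hb.mul (ha.div hb))).of_eq fun v => by
    have := Nat.mod_add_div (a v) (b v)
    omega

theorem Elementary.dvd {n : ℕ} {a b : (Fin n → ℕ) → ℕ} (ha : Elementary a)
    (hb : Elementary b) : ElementaryPred fun v => a v ∣ b v :=
  ((hb.mod ha).eq (.const 0)).of_iff fun _ => (Nat.dvd_iff_mod_eq_zero).symm

theorem Elementary.gcd {n : ℕ} {a b : (Fin n → ℕ) → ℕ} (ha : Elementary a)
    (hb : Elementary b) : Elementary fun v => Nat.gcd (a v) (b v) := by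
  classical
  refine Elementary.comp₂ (φ := fun x y => Nat.gcd x y) ?_ ha hb
  refine (Elementary.findGreatest (p := fun d v => d ∣ v 0 ∧ d ∣ v 1) (t := fun v => v 0 + v 1)
    (.and (.dvd (.proj 0) (.proj 1)) (.dvd (.proj 0) (.proj 2)))
    (.add (.proj 0) (.proj 1))).of_eq fun v => ?_
  rw [Nat.findGreatest_eq_iff]
  refine ⟨?_, fun _ => ⟨Nat.gcd_dvd_left _ _, Nat.gcd_dvd_right _ _⟩, fun d hd hle h' => ?_⟩
  · rcases Nat.eq_zero_or_pos (v 0) with h | h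
    · simp [h]
    · exact (Nat.gcd_le_left _ h).trans (Nat.le_add_right _ _)
  · have hpos : 0 < Nat.gcd (v 0) (v 1) := by
      rw [Nat.pos_iff_ne_zero, Ne, Nat.gcd_eq_zero_iff]
      omega
    exact absurd (Nat.le_of_dvd hpos (Nat.dvd_gcd h'.1 h'.2)) (by omega)

theorem Elementary.pair {n : ℕ} {a b : (Fin n → ℕ) → ℕ} (ha : Elementary a)
    (hb : Elementary b) : Elementary fun v => Nat.pair (a v) (b v) :=
  (Elementary.ite (ha.add_one.le hb) ((hb.mul hb).add ha) (((ha.mul ha).add ha).add hb)).of_eq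
    fun _ => rfl

/-- The quotient of two elementary functions is an elementary function with rational values:
the reduced form is found by dividing by the greatest common divisor. -/
theorem ElementaryRat.div {N M : ℕ → ℕ} (hN : Elementary fun v : Fin 1 → ℕ => N (v 0))
    (hM : Elementary fun v : Fin 1 → ℕ => M (v 0)) (hpos : ∀ i, 0 < M i) :
    ElementaryRat fun i => (N i : ℚ) / M i := by
  refine Elementary.of_eq (((Elementary.const 2).mul (hN.div (hN.gcd hM))).pair
    (hM.div (hN.gcd hM))) fun v => ?_
  generalize v 0 = i
  obtain ⟨g, n, m, hg, hco, hn, hm⟩ := Nat.exists_coprime' (Nat.gcd_pos_of_pos_right (N i) (hpos i))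
  have hm0 : 0 < m := Nat.pos_of_mul_pos_right (by rw [← hm]; exact hpos i)
  have hgcd : Nat.gcd (N i) (M i) = g := by rw [hn, hm, Nat.gcd_mul_right, hco.gcd_eq_one, one_mul]
  have hq : (N i : ℚ) / M i = ((n : ℤ) : ℚ) / ((m : ℤ) : ℚ) := by
    rw [hn, hm]
    push_cast
    rw [mul_div_mul_right _ _ (by positivity)]
  have hnum := Rat.num_div_eq_of_coprime (a := (n : ℤ)) (b := (m : ℤ)) (by exact_mod_cast hm0)
    (by simpa using hco)
  have hden := Rat.den_div_eq_of_coprime (a := (n : ℤ)) (b := (m : ℤ)) (by exact_mod_cast hm0)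
    (by simpa using hco)
  simp only [ratCode]
  rw [hq, hnum, show ((n : ℤ) / (m : ℤ) : ℚ).den = m by exact_mod_cast hden, hgcd,
    hn, hm, Nat.mul_div_cancel _ hg, Nat.mul_div_cancel _ hg]
  rfl

/-- The enumeration of an infinite elementary set is elementary as soon as it is bounded by an
elementary function. -/
theorem Elementary.nth {n : ℕ} {p : ℕ → Prop} {B : ℕ → ℕ} {t : (Fin n → ℕ) → ℕ}
    (hp : ElementaryPred fun v : Fin 1 → ℕ => p (v 0)) (hinf : {x | p x}.Infinite)
    (hB : Elementary fun v : Fin 1 → ℕ => B (v 0)) (h_le : ∀ i, Nat.nth p i ≤ B i)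
    (ht : Elementary t) : Elementary fun v => Nat.nth p (t v) := by
  classical
  refine Elementary.comp₁ (φ := fun x => Nat.nth p x) ?_ ht
  have hp' : ∀ {m : ℕ} (i : Fin m), ElementaryPred fun v : Fin m → ℕ => p (v i) := fun i =>
    Elementary.comp₁ (φ := fun x => if p x then 1 else 0) hp (.proj i)
  refine (Elementary.findGreatest (p := fun x v => p x ∧ Nat.count p x = v 0) (.and (hp' 0)
    (.eq (Elementary.count (p := fun x _ => p x) (hp' 0) (.proj 0)) (.proj 1))) hB).of_eq
    fun v => ?_
  rw [Nat.findGreatest_eq_iff]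
  refine ⟨h_le _, fun _ => ⟨Nat.nth_mem_of_infinite hinf _, Nat.count_nth_of_infinite hinf _⟩,
    fun x hx _ h' => ?_⟩
  rw [← h'.2, Nat.nth_count h'.1] at hx
  exact lt_irrefl _ hx

theorem ElementaryPred.prime : ElementaryPred fun v : Fin 1 → ℕ => (v 0).Prime := by
  refine ElementaryPred.of_iff (.and (.le (.const 2) (.proj 0)) (ElementaryPred.ball_lt
    (p := fun m v => m ∣ v 0 → m = 1) (.imp (.dvd (.proj 0) (.proj 1)) (.eq (.proj 0) (.const 1)))
    (.proj 0))) fun v => ?_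
  exact Nat.prime_def_lt.symm

/-! ### The primes and the functions `g` and `h` -/

theorem prime_P (j : ℕ) : (P j).Prime := Nat.prime_nth_prime j

theorem P_strictMono : StrictMono P := Nat.nth_strictMono Nat.infinite_setOfPred_prime

theorem lt_P (j : ℕ) : j < P j :=
  lt_of_lt_of_le (by omega) (Nat.add_two_le_nth_prime j)

/-- Bertrand's postulate bounds the sequence of primes by powers of two. -/
theorem P_le_two_pow (j : ℕ) : P j ≤ 2 ^ (j + 1) := by
  induction j with
  | zero => simp [P, Nat.nth_prime_zero_eq_two]
  | succ j ih =>
    obtain ⟨q, hq, hlt, hle⟩ := Nat.exists_prime_lt_and_le_two_mul (P j) (prime_P j).ne_zero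
    have hcount : j < Nat.count Nat.Prime q :=
      (Nat.nth_strictMono Nat.infinite_setOfPred_prime).lt_iff_lt.1
        (hlt.trans_eq (Nat.nth_count hq).symm)
    calc P (j + 1) ≤ P (Nat.count Nat.Prime q) := P_strictMono.monotone hcount
      _ = q := Nat.nth_count hq
      _ ≤ 2 ^ (j + 1 + 1) := by rw [pow_succ]; omega

theorem Elementary.P {n : ℕ} {a : (Fin n → ℕ) → ℕ} (ha : Elementary a) :
    Elementary fun v => P (a v) :=
  Elementary.nth .prime Nat.infinite_setOfPred_prime (B := fun j => 2 ^ (j + 1))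
    (.two_pow (.add_one (.proj 0))) P_le_two_pow ha

theorem g_strictMono : StrictMono g := by
  refine strictMono_nat_of_lt_succ fun j => ?_
  have h1 : g j + 1 ≤ 2 * (j + 2) * (g j + 1) ^ 3 :=
    (Nat.le_self_pow (by norm_num) _).trans (Nat.le_mul_of_pos_left _ (by positivity))
  calc g j < 2 * (j + 2) * (g j + 1) ^ 3 := h1
    _ ≤ 2 ^ (2 * (j + 2) * (g j + 1) ^ 3) := Nat.lt_two_pow_self.le
    _ ≤ g (j + 1) := Nat.pow_le_pow_left (prime_P j).two_le _

/-- The values of `g` exceed every elementary bound, but their truncations do not: this is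
why only truncations of `f`, `g` and `h` occur below. -/
theorem Elementary.min_g {n : ℕ} {a c : (Fin n → ℕ) → ℕ} (ha : Elementary a)
    (hc : Elementary c) : Elementary fun v => min (g (a v)) (c v) := by
  refine Elementary.comp₂ (φ := fun x y => min (g x) y) ?_ ha hc
  refine Elementary.curryRec (F := fun x v => min (g x) (v 1))
    (step := fun j z v => min (SumApprox.P j ^ (2 * (j + 2) * (z + 1) ^ 3)) (v 1))
    (bound := fun _ v => v 1) (.proj 0) (.inf (.const 1) (.proj 1)) ?_ (.proj 2) (fun _ => rfl) ?_
    (fun _ _ => min_le_right _ _)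
  · exact .inf (.pow (.P (.proj 0)) (.mul (.mul (.const 2) (.add (.proj 0) (.const 2)))
      (.pow (.add (.proj 1) (.const 1)) (.const 3)))) (.proj 3)
  · intro j v
    rcases le_total (g j) (v 1) with hle | hle
    · simp [min_eq_left hle, g]
    · have h1 : v 1 ≤ SumApprox.P j ^ (2 * (j + 2) * (v 1 + 1) ^ 3) := by
        have h2 : v 1 + 1 ≤ 2 * (j + 2) * (v 1 + 1) ^ 3 :=
          (Nat.le_self_pow (by norm_num) _).trans (Nat.le_mul_of_pos_left _ (by positivity))
        have h3 : 2 ^ (2 * (j + 2) * (v 1 + 1) ^ 3) ≤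
            SumApprox.P j ^ (2 * (j + 2) * (v 1 + 1) ^ 3) :=
          Nat.pow_le_pow_left (prime_P j).two_le _
        have h4 := (Nat.lt_two_pow_self (n := 2 * (j + 2) * (v 1 + 1) ^ 3))
        omega
      have h2 : v 1 ≤ g (j + 1) := hle.trans (g_strictMono.monotone (Nat.le_succ j))
      simp only [min_eq_right hle, min_eq_right h1, min_eq_right h2]

theorem Honest.pos {f : ℕ → ℕ} (hf : Honest f) (x : ℕ) : 0 < f x :=
  (Nat.two_pow_pos x).trans_le (hf.two_pow_le x)

/-- The elementary graph of an honest function is enough to compute its truncations, by a search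
for the value below the truncation bound; as `f` has no zeros, a failed search is recognized by
its result `0`. -/
theorem Honest.elementary_min {f : ℕ → ℕ} (hf : Honest f) {n : ℕ}
    {a c : (Fin n → ℕ) → ℕ} (ha : Elementary a) (hc : Elementary c) :
    Elementary fun v => min (f (a v)) (c v) := by
  classical
  refine Elementary.comp₂ (φ := fun x y => min (f x) y) ?_ ha hc
  have hgraph : ElementaryPred fun w : Fin 3 → ℕ => f (w 1) = w 0 :=
    ElementaryPred.comp₂ (p := fun x y => f x = y) hf.graph (.proj 1) (.proj 0)
  have hs : Elementary fun v : Fin 2 → ℕ => Nat.findGreatest (fun z => f (v 0) = z) (v 1) :=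
    Elementary.findGreatest (p := fun z v => f (v 0) = z) hgraph (.proj 1)
  refine (Elementary.ite (hs.eq (.const 0)) (.proj 1) hs).of_eq fun v => ?_
  rcases le_or_gt (f (v 0)) (v 1) with hle | hlt
  · have : Nat.findGreatest (fun z => f (v 0) = z) (v 1) = f (v 0) :=
      Nat.findGreatest_eq_iff.2 ⟨hle, fun _ => rfl, fun z hz _ => hz.ne⟩
    rw [this, if_neg (hf.pos _).ne', min_eq_left hle]
  · have : Nat.findGreatest (fun z => f (v 0) = z) (v 1) = 0 :=
      Nat.findGreatest_eq_zero_iff.2 fun z _ hz => (hz.trans_lt hlt).ne'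
    rw [this, if_pos rfl, min_eq_right hlt.le]

theorem Honest.elementary_min_h {f : ℕ → ℕ} (hf : Honest f) {n : ℕ}
    {a c : (Fin n → ℕ) → ℕ} (ha : Elementary a) (hc : Elementary c) :
    Elementary fun v => min (h f (a v)) (c v) := by
  refine (Elementary.min_g ((hf.elementary_min ha hc).add ha) hc).of_eq fun v => ?_
  rcases le_total (f (a v)) (c v) with hle | hle
  · rw [min_eq_left hle, h]
  · have h1 : c v ≤ g (c v + a v) := (Nat.le_add_right _ _).trans (le_g _)
    have h2 : c v ≤ h f (a v) := (hle.trans (Nat.le_add_right _ _)).trans (le_g _)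
    rw [min_eq_right hle, min_eq_right h1, min_eq_right h2]

theorem Honest.lt_h {f : ℕ → ℕ} (hf : Honest f) (n : ℕ) : n < h f n :=
  lt_of_lt_of_le (by have := hf.pos n; omega) (le_g (f n + n))

theorem Honest.h_strictMono {f : ℕ → ℕ} (hf : Honest f) : StrictMono (h f) := by
  refine strictMono_nat_of_lt_succ fun n => g_strictMono ?_
  have := hf.mono n
  omega

theorem Honest.two_pow_le_h_succ {f : ℕ → ℕ} (hf : Honest f) (n : ℕ) :
    2 ^ (4 * h f n ^ 3) ≤ h f (n + 1) := by
  have h1 : f n + n + 1 ≤ f (n + 1) + (n + 1) := by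
    have := hf.mono n
    omega
  have h2 : 4 * h f n ^ 3 ≤ 2 * (f n + n + 2) * (g (f n + n) + 1) ^ 3 :=
    Nat.mul_le_mul (by omega) (Nat.pow_le_pow_left (Nat.le_succ _) 3)
  calc 2 ^ (4 * h f n ^ 3) ≤ 2 ^ (2 * (f n + n + 2) * (g (f n + n) + 1) ^ 3) :=
        Nat.pow_le_pow_right (by norm_num) h2
    _ ≤ g (f n + n + 1) := Nat.pow_le_pow_left (prime_P _).two_le _
    _ ≤ h f (n + 1) := g_strictMono.monotone h1

/-! ### The partial sums of `α` as fractions -/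

/-- The common denominator of the first `n` terms of the series for `α`. -/
noncomputable def denom (f : ℕ → ℕ) (n : ℕ) : ℕ := ∏ j ∈ Finset.range n, P j ^ h f j

/-- The numerator of the sum of the first `n` terms over `denom f n`. -/
noncomputable def numer (f : ℕ → ℕ) (n : ℕ) : ℕ :=
  ∑ j ∈ Finset.range n, denom f n / P j ^ h f j

theorem denom_pos (f : ℕ → ℕ) (n : ℕ) : 0 < denom f n :=
  Finset.prod_pos fun j _ => Nat.pow_pos (prime_P j).pos

theorem denom_succ (f : ℕ → ℕ) (n : ℕ) : denom f (n + 1) = denom f n * P n ^ h f n :=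
  Finset.prod_range_succ _ n

theorem pow_dvd_denom (f : ℕ → ℕ) {j n : ℕ} (hj : j < n) : P j ^ h f j ∣ denom f n :=
  Finset.dvd_prod_of_mem _ (Finset.mem_range.2 hj)

theorem numer_succ (f : ℕ → ℕ) (n : ℕ) :
    numer f (n + 1) = numer f n * P n ^ h f n + denom f n := by
  rw [numer, Finset.sum_range_succ, denom_succ,
    Nat.mul_div_cancel _ (Nat.pow_pos (prime_P n).pos), numer, Finset.sum_mul]
  congr 1
  exact Finset.sum_congr rfl fun j hj =>
    (Nat.div_mul_right_comm (pow_dvd_denom f (Finset.mem_range.1 hj)) _).symm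

theorem sum_eq_numer_div_denom (f : ℕ → ℕ) (n : ℕ) :
    ∑ j ∈ Finset.range n, ((P j : ℝ) ^ h f j)⁻¹ = numer f n / denom f n := by
  induction n with
  | zero => simp [numer]
  | succ n ih =>
    have h1 : (denom f n : ℝ) ≠ 0 := by exact_mod_cast (denom_pos f n).ne'
    have h2 : (P n : ℝ) ≠ 0 := by exact_mod_cast (prime_P n).ne_zero
    rw [Finset.sum_range_succ, ih, numer_succ, denom_succ]
    push_cast
    field_simp

/-- A partial sum of the series for `α` that ends with a prime not dividing `b` has no finite
base-`b` expansion. -/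
theorem not_denom_dvd {f : ℕ → ℕ} (hf : Honest f) {b n : ℕ} (hb : ¬ P n ∣ b) (k : ℕ) :
    ¬ denom f (n + 1) ∣ b ^ k * numer f (n + 1) := by
  intro hdvd
  have hp : P n ∣ P n ^ h f n := dvd_pow_self _ (by have := hf.lt_h n; omega)
  have h1 : P n ∣ b ^ k * numer f (n + 1) :=
    (hp.trans (pow_dvd_denom f (Nat.lt_succ_self n))).trans hdvd
  rw [numer_succ, mul_add] at h1
  have h2 : P n ∣ b ^ k * denom f n :=
    (Nat.dvd_add_right ((hp.mul_left _).mul_left _)).1 h1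
  rcases (prime_P n).dvd_mul.1 h2 with h3 | h3
  · exact hb ((prime_P n).dvd_of_dvd_pow h3)
  · obtain ⟨j, hj, hj'⟩ := (prime_P n).prime.exists_mem_finset_dvd h3
    have h4 := (Nat.prime_dvd_prime_iff_eq (prime_P n) (prime_P j)).1
      ((prime_P n).dvd_of_dvd_pow hj')
    exact (Finset.mem_range.1 hj).ne' (P_strictMono.injective h4)

theorem Honest.denom_succ_le {f : ℕ → ℕ} (hf : Honest f) (n : ℕ) :
    denom f (n + 1) ≤ 2 ^ h f n ^ 3 := by
  have h1 : ∀ j ∈ Finset.range (n + 1), P j ^ h f j ≤ 2 ^ (h f n ^ 2) := by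
    intro j hj
    have hjn : j ≤ n := Nat.lt_succ_iff.1 (Finset.mem_range.1 hj)
    calc P j ^ h f j ≤ (2 ^ (j + 1)) ^ h f j := Nat.pow_le_pow_left (P_le_two_pow j) _
      _ = 2 ^ ((j + 1) * h f j) := (pow_mul _ _ _).symm
      _ ≤ 2 ^ (h f n ^ 2) := by
        refine Nat.pow_le_pow_right (by norm_num) ?_
        rw [sq]
        have := hf.lt_h n
        exact Nat.mul_le_mul (by omega) (hf.h_strictMono.monotone hjn)
  calc denom f (n + 1) ≤ ∏ _j ∈ Finset.range (n + 1), 2 ^ (h f n ^ 2) := Finset.prod_le_prod' h1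
    _ = 2 ^ (h f n ^ 2 * (n + 1)) := by rw [Finset.prod_const, Finset.card_range, ← pow_mul]
    _ ≤ 2 ^ h f n ^ 3 := by
      refine Nat.pow_le_pow_right (by norm_num) ?_
      rw [pow_succ (h f n) 2]
      exact Nat.mul_le_mul_left _ (hf.lt_h n)

theorem hasSum_alpha (f : ℕ → ℕ) : HasSum (fun i => ((P i : ℝ) ^ h f i)⁻¹) (alpha f) := by
  rw [hasSum_iff_tendsto_nat_of_nonneg fun i => by positivity,
    ← Filter.tendsto_add_atTop_iff_nat 1]
  refine (tendsto_alphaPartial f).congr fun n => ?_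
  simp [alphaPartial]

theorem numer_div_denom_le_alpha (f : ℕ → ℕ) (n : ℕ) : (numer f n : ℝ) / denom f n ≤ alpha f := by
  rw [← sum_eq_numer_div_denom]
  exact sum_le_hasSum _ (fun i _ => by positivity) (hasSum_alpha f)

theorem Honest.alpha_le {f : ℕ → ℕ} (hf : Honest f) (n : ℕ) :
    alpha f ≤ numer f n / denom f n + 2 / 2 ^ h f n := by
  rw [← sum_eq_numer_div_denom, ← (hasSum_alpha f).tsum_eq,
    ← (hasSum_alpha f).summable.sum_add_tsum_nat_add n]
  refine add_le_add_right ?_ _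
  have hgeo : HasSum (fun i : ℕ => (2 ^ h f n : ℝ)⁻¹ * (1 / 2) ^ i) ((2 ^ h f n : ℝ)⁻¹ * 2) :=
    hasSum_geometric_two.mul_left _
  rw [div_eq_mul_inv, mul_comm, ← hgeo.tsum_eq]
  refine Summable.tsum_le_tsum (fun i => ?_)
    ((summable_nat_add_iff n).2 (hasSum_alpha f).summable) hgeo.summable
  have h1 : h f n + i ≤ h f (i + n) := by
    rw [add_comm (h f n) i]
    exact hf.h_strictMono.add_le_nat i n
  rw [one_div, inv_pow, ← mul_inv, ← pow_add]
  refine inv_anti₀ (by positivity) ?_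
  calc (2 : ℝ) ^ (h f n + i) ≤ 2 ^ h f (i + n) := pow_le_pow_right₀ (by norm_num) h1
    _ ≤ (P (i + n) : ℝ) ^ h f (i + n) :=
      pow_le_pow_left₀ (by norm_num) (by exact_mod_cast (prime_P _).two_le) _

/-- If the tail of the series is smaller than the distance from a partial sum to the next multiple
of `b ^ (-k)`, the partial sum determines the first `k` digits. -/
theorem Honest.floor_pow_mul_alpha {f : ℕ → ℕ} (hf : Honest f) {b k n : ℕ}
    (hn : 2 * b ^ k * denom f n < 2 ^ h f n) :
    ⌊(b : ℝ) ^ k * alpha f⌋₊ = b ^ k * numer f n / denom f n := by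
  have hD : (0 : ℝ) < denom f n := by exact_mod_cast denom_pos f n
  have h0 : (0 : ℝ) ≤ numer f n / denom f n := by positivity
  have h1 := numer_div_denom_le_alpha f n
  have h2 := hf.alpha_le n
  have hbk : (0 : ℝ) ≤ (b : ℝ) ^ k := by positivity
  set m := b ^ k * numer f n / denom f n
  have hm1 : (m : ℝ) * denom f n ≤ b ^ k * numer f n := by
    exact_mod_cast Nat.div_mul_le_self _ _
  have hm2 : (b : ℝ) ^ k * numer f n + 1 ≤ (m + 1) * denom f n := by
    exact_mod_cast Nat.lt_div_mul_add (denom_pos f n) |>.trans_eq (by ring)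
  rw [Nat.floor_eq_iff (mul_nonneg hbk (h0.trans h1))]
  constructor
  · refine le_trans ?_ (mul_le_mul_of_nonneg_left h1 hbk)
    rw [← mul_div_assoc, le_div_iff₀ hD]
    exact hm1
  · have h3 : (b : ℝ) ^ k * (2 / 2 ^ h f n) < 1 / denom f n := by
      rw [← mul_div_assoc, div_lt_div_iff₀ (by positivity) hD, one_mul]
      have : (2 * b ^ k * denom f n : ℝ) < 2 ^ h f n := by exact_mod_cast hn
      linarith
    have h4 : (b : ℝ) ^ k * (numer f n / denom f n) + 1 / denom f n ≤ m + 1 := by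
      rw [← mul_div_assoc, ← add_div, div_le_iff₀ hD]
      exact hm2
    have h5 := mul_le_mul_of_nonneg_left h2 hbk
    rw [mul_add] at h5
    linarith

/-- Under the same condition, `α` stays away from its truncation to `k` digits by at least
`b ^ (-k) / denom f n`, provided the partial sum has no finite base-`b` expansion. -/
theorem Honest.floor_add_le {f : ℕ → ℕ} (hf : Honest f) {b k n : ℕ} (hb : ¬ P n ∣ b)
    (hn : 2 * b ^ k * denom f (n + 1) < 2 ^ h f (n + 1)) :
    (⌊(b : ℝ) ^ k * alpha f⌋₊ : ℝ) + 1 / denom f (n + 1) ≤ b ^ k * alpha f := by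
  have hD : (0 : ℝ) < denom f (n + 1) := by exact_mod_cast denom_pos f (n + 1)
  have h1 := numer_div_denom_le_alpha f (n + 1)
  rw [hf.floor_pow_mul_alpha hn]
  set m := b ^ k * numer f (n + 1) / denom f (n + 1)
  have hlt : m * denom f (n + 1) < b ^ k * numer f (n + 1) :=
    lt_of_le_of_ne (Nat.div_mul_le_self _ _) fun heq =>
      not_denom_dvd hf hb k (Dvd.intro_left _ heq)
  have hlt' : (m : ℝ) * denom f (n + 1) + 1 ≤ b ^ k * numer f (n + 1) := by exact_mod_cast hlt
  refine le_trans ?_ (mul_le_mul_of_nonneg_left h1 (by positivity))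
  rw [← mul_div_assoc, le_div_iff₀ hD, add_mul, one_div, inv_mul_cancel₀ hD.ne']
  exact hlt'

/-- A sufficient condition for `floor_pow_mul_alpha` and `floor_add_le`, free of powers. -/
theorem Honest.two_mul_pow_mul_denom_lt {f : ℕ → ℕ} (hf : Honest f) {b k n : ℕ}
    (hn : 1 + k * b + h f n ^ 3 < h f (n + 1)) :
    2 * b ^ k * denom f (n + 1) < 2 ^ h f (n + 1) := by
  calc 2 * b ^ k * denom f (n + 1) ≤ 2 * (2 ^ b) ^ k * 2 ^ h f n ^ 3 :=
        Nat.mul_le_mul (Nat.mul_le_mul_left _ (Nat.pow_le_pow_left Nat.lt_two_pow_self.le _))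
          (hf.denom_succ_le n)
    _ = 2 ^ (1 + k * b + h f n ^ 3) := by ring
    _ < 2 ^ h f (n + 1) := Nat.pow_lt_pow_right (by norm_num) hn

/-! ### The function `k ↦ ⌊b ^ k * α⌋` is elementary -/

theorem prod_P_pow_min_le (f : ℕ → ℕ) (n y : ℕ) :
    ∏ j ∈ Finset.range n, P j ^ min (h f j) y ≤ 2 ^ (n * y * n) := by
  have h1 : ∀ j ∈ Finset.range n, P j ^ min (h f j) y ≤ 2 ^ (n * y) := by
    intro j hj
    have hjn : j + 1 ≤ n := Finset.mem_range.1 hj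
    calc P j ^ min (h f j) y ≤ (2 ^ (j + 1)) ^ min (h f j) y :=
          Nat.pow_le_pow_left (P_le_two_pow j) _
      _ = 2 ^ ((j + 1) * min (h f j) y) := (pow_mul _ _ _).symm
      _ ≤ 2 ^ (n * y) :=
        Nat.pow_le_pow_right (by norm_num) (Nat.mul_le_mul hjn (min_le_right _ _))
  calc ∏ j ∈ Finset.range n, P j ^ min (h f j) y ≤ ∏ _j ∈ Finset.range n, 2 ^ (n * y) :=
        Finset.prod_le_prod' h1
    _ = 2 ^ (n * y * n) := by rw [Finset.prod_const, Finset.card_range, ← pow_mul]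

/-- The number of terms of the series with exponent at most `y`. -/
noncomputable def numTerms (f : ℕ → ℕ) (y : ℕ) : ℕ :=
  Nat.findGreatest (fun n => h f (n - 1) ≤ y) (y + 1)

theorem Honest.h_le_of_lt_numTerms {f : ℕ → ℕ} (hf : Honest f) {j y : ℕ}
    (hj : j < numTerms f y) : h f j ≤ y := by
  have h1 : h f (numTerms f y - 1) ≤ y :=
    Nat.findGreatest_of_ne_zero (P := fun n => h f (n - 1) ≤ y) rfl (by omega)
  exact (hf.h_strictMono.monotone (by omega)).trans h1

theorem Honest.lt_h_numTerms {f : ℕ → ℕ} (hf : Honest f) (y : ℕ) : y < h f (numTerms f y) := by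
  by_contra! hle
  have h1 := hf.lt_h (numTerms f y)
  have h2 : numTerms f y + 1 ≤ numTerms f y :=
    Nat.le_findGreatest (P := fun n => h f (n - 1) ≤ y) (by omega) hle
  omega

theorem Honest.elementary_numTerms {f : ℕ → ℕ} (hf : Honest f) {n : ℕ} {a : (Fin n → ℕ) → ℕ}
    (ha : Elementary a) : Elementary fun v => numTerms f (a v) := by
  classical
  refine Elementary.comp₁ (φ := fun y => numTerms f y) ?_ ha
  refine Elementary.findGreatest (p := fun n v => h f (n - 1) ≤ v 0) ?_ (.add_one (.proj 0))
  refine (Elementary.le (hf.elementary_min_h (.pred (.proj 0)) (.add_one (.proj 1)))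
    (.proj 1)).of_iff fun v => ?_
  show min (h f (v 0 - 1)) (v 1 + 1) ≤ v 1 ↔ h f (v 0 - 1) ≤ v 1
  omega

theorem Honest.elementary_denom_numTerms {f : ℕ → ℕ} (hf : Honest f) :
    Elementary fun v : Fin 1 → ℕ => denom f (numTerms f (v 0)) := by
  refine (Elementary.prod_range (φ := fun j v => P j ^ min (h f j) (v 0))
    (B := fun n v => 2 ^ (n * v 0 * n)) (.pow (.P (.proj 0)) (hf.elementary_min_h (.proj 0)
    (.proj 1))) (.two_pow (.mul (.mul (.proj 0) (.proj 1)) (.proj 0)))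
    (fun n v => prod_P_pow_min_le f n (v 0)) (hf.elementary_numTerms (.proj 0))).of_eq fun v => ?_
  refine Finset.prod_congr rfl fun j hj => ?_
  rw [min_eq_left (hf.h_le_of_lt_numTerms (Finset.mem_range.1 hj))]

theorem Honest.elementary_numer_numTerms {f : ℕ → ℕ} (hf : Honest f) :
    Elementary fun v : Fin 1 → ℕ => numer f (numTerms f (v 0)) := by
  have hD : Elementary fun v : Fin 2 → ℕ => denom f (numTerms f (v 1)) :=
    Elementary.comp₁ (φ := fun y => denom f (numTerms f y)) hf.elementary_denom_numTerms (.proj 1)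
  refine (Elementary.sum_range
    (φ := fun j v => denom f (numTerms f (v 0)) / P j ^ min (h f j) (v 0))
    (B := fun n v => n * denom f (numTerms f (v 0))) (.div hD (.pow (.P (.proj 0))
    (hf.elementary_min_h (.proj 0) (.proj 1)))) (.mul (.proj 0) hD)
    (fun n v => ?_) (hf.elementary_numTerms (.proj 0))).of_eq fun v => ?_
  · refine (Finset.sum_le_card_nsmul _ _ _ fun j _ => Nat.div_le_self _ _).trans_eq ?_
    rw [Finset.card_range, smul_eq_mul]
  · refine Finset.sum_congr rfl fun j hj => ?_
    rw [min_eq_left (hf.h_le_of_lt_numTerms (Finset.mem_range.1 hj))]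

theorem Honest.four_mul_h_pow_lt {f : ℕ → ℕ} (hf : Honest f) (n : ℕ) :
    4 * h f n ^ 3 < h f (n + 1) :=
  Nat.lt_two_pow_self.trans_le (hf.two_pow_le_h_succ n)

theorem Honest.elementary_floor {f : ℕ → ℕ} (hf : Honest f) (b : ℕ) {n : ℕ}
    {a : (Fin n → ℕ) → ℕ} (ha : Elementary a) :
    Elementary fun v => ⌊(b : ℝ) ^ a v * alpha f⌋₊ := by
  refine Elementary.comp₁ (φ := fun k => ⌊(b : ℝ) ^ k * alpha f⌋₊) ?_ ha
  -- If `h n` exceeds both `2 * (1 + k * b)` and `4 * h (n - 1) ^ 3`, it exceeds their mean, which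
  -- suffices for `floor_pow_mul_alpha`; hence the cutoff.
  have hy : Elementary fun v : Fin 1 → ℕ => 2 * (1 + v 0 * b) :=
    .mul (.const 2) (.add (.const 1) (.mul (.proj 0) (.const b)))
  refine (Elementary.div (.mul (.pow (.const b) (.proj 0))
    (Elementary.comp₁ (φ := fun y => numer f (numTerms f y)) hf.elementary_numer_numTerms hy))
    (Elementary.comp₁ (φ := fun y => denom f (numTerms f y))
    hf.elementary_denom_numTerms hy)).of_eq fun v => ?_
  refine (hf.floor_pow_mul_alpha ?_).symm
  generalize v 0 = k
  have h1 := hf.lt_h_numTerms (2 * (1 + k * b))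
  generalize numTerms f (2 * (1 + k * b)) = n at h1
  cases n with
  | zero =>
    have h2 : b ^ k ≤ 2 ^ (k * b) := by
      rw [mul_comm, pow_mul]
      exact Nat.pow_le_pow_left Nat.lt_two_pow_self.le _
    calc 2 * b ^ k * denom f 0 ≤ 2 ^ (1 + k * b) := by
          rw [denom, Finset.prod_range_zero, mul_one, pow_add, pow_one]
          exact Nat.mul_le_mul_left _ h2
      _ < 2 ^ h f 0 := Nat.pow_lt_pow_right (by norm_num) (by omega)
  | succ n =>
    have h2 := hf.four_mul_h_pow_lt n
    exact hf.two_mul_pow_mul_denom_lt (by omega)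

/-! ### Sum approximations and digits of an arbitrary real number -/

/-- The `k`-th digit after the point of the base-`b` expansion of `x ∈ [0, 1)`; the `0`-th is
the last digit of the integer part. -/
noncomputable def digit (b : ℕ) (x : ℝ) (k : ℕ) : ℕ := ⌊(b : ℝ) ^ k * x⌋₊ % b

/-- The position of the `i`-th nonzero digit of `x`, where the position of the `0`-th is `0` by
convention. -/
noncomputable def digitPos (b : ℕ) (x : ℝ) : ℕ → ℕ :=
  Nat.nth fun k => k = 0 ∨ digit b x k ≠ 0

theorem floor_pow_succ {b : ℕ} (hb : 2 ≤ b) (x : ℝ) (k : ℕ) :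
    ⌊(b : ℝ) ^ (k + 1) * x⌋₊ = b * ⌊(b : ℝ) ^ k * x⌋₊ + digit b x (k + 1) := by
  have hb0 : (b : ℝ) ≠ 0 := by positivity
  have h1 : ⌊(b : ℝ) ^ k * x⌋₊ = ⌊(b : ℝ) ^ (k + 1) * x⌋₊ / b := by
    rw [← Nat.floor_div_natCast, pow_succ]
    congr 1
    field_simp
  rw [h1, digit, Nat.div_add_mod]

theorem floor_pow_add_of_digit_eq_zero {b : ℕ} (hb : 2 ≤ b) {x : ℝ} {k l : ℕ}
    (h0 : ∀ m, k < m → m ≤ k + l → digit b x m = 0) :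
    ⌊(b : ℝ) ^ (k + l) * x⌋₊ = b ^ l * ⌊(b : ℝ) ^ k * x⌋₊ := by
  induction l with
  | zero => simp
  | succ l ih =>
    rw [← add_assoc, floor_pow_succ hb, ih fun m h1 h2 => h0 m h1 (by omega),
      h0 (k + l + 1) (by omega) (by omega), pow_succ]
    ring

section DigitPos

variable {b : ℕ} {x : ℝ}

theorem digitPos_zero : digitPos b x 0 = 0 := Nat.nth_zero_of_zero (Or.inl rfl)

theorem infinite_digit (hinf : ∀ k, ∃ m, k < m ∧ digit b x m ≠ 0) :
    {k | k = 0 ∨ digit b x k ≠ 0}.Infinite :=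
  Set.infinite_of_forall_exists_gt fun k =>
    let ⟨m, hm, hd⟩ := hinf k
    ⟨m, Or.inr hd, hm⟩

theorem digitPos_strictMono (hinf : ∀ k, ∃ m, k < m ∧ digit b x m ≠ 0) :
    StrictMono (digitPos b x) :=
  Nat.nth_strictMono (infinite_digit hinf)

theorem digit_digitPos_ne_zero (hinf : ∀ k, ∃ m, k < m ∧ digit b x m ≠ 0) (i : ℕ) :
    digit b x (digitPos b x (i + 1)) ≠ 0 := by
  refine (Nat.nth_mem_of_infinite (infinite_digit hinf) (i + 1)).resolve_left fun h0 => ?_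
  have := digitPos_strictMono hinf (Nat.succ_pos i)
  rw [digitPos_zero] at this
  exact this.ne' h0

theorem digitPos_succ_le (hinf : ∀ k, ∃ m, k < m ∧ digit b x m ≠ 0) {i m : ℕ}
    (hm : digitPos b x i < m) (hd : digit b x m ≠ 0) : digitPos b x (i + 1) ≤ m := by
  classical
  have h1 : digitPos b x (Nat.count (fun k => k = 0 ∨ digit b x k ≠ 0) m) = m :=
    Nat.nth_count (p := fun k => k = 0 ∨ digit b x k ≠ 0) (Or.inr hd)
  rw [← h1] at hm ⊢
  exact (digitPos_strictMono hinf).monotone ((digitPos_strictMono hinf).lt_iff_lt.1 hm)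

theorem sum_digit_digitPos (hb : 2 ≤ b) (hx : x < 1)
    (hinf : ∀ k, ∃ m, k < m ∧ digit b x m ≠ 0) (i : ℕ) :
    ∑ j ∈ Finset.range (i + 1), (digit b x (digitPos b x j) : ℝ) / b ^ digitPos b x j =
      ⌊(b : ℝ) ^ digitPos b x i * x⌋₊ / b ^ digitPos b x i := by
  have hb0 : (b : ℝ) ≠ 0 := by positivity
  induction i with
  | zero => simp [digitPos_zero, digit, Nat.floor_eq_zero.2 hx]
  | succ i ih =>
    obtain ⟨l, hl⟩ : ∃ l, digitPos b x (i + 1) = digitPos b x i + l + 1 :=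
      Nat.exists_eq_add_of_lt (digitPos_strictMono hinf (Nat.lt_succ_self i))
    have h0 : ∀ m, digitPos b x i < m → m ≤ digitPos b x i + l → digit b x m = 0 := by
      intro m h1 h2
      by_contra hd
      have := digitPos_succ_le hinf h1 hd
      omega
    have h1 := floor_pow_add_of_digit_eq_zero hb h0
    rw [Finset.sum_range_succ, ih, hl, floor_pow_succ hb, h1]
    push_cast
    rw [pow_succ, pow_add]
    field_simp

theorem isSumApproxBelow_digit (hb : 2 ≤ b) (h0 : 0 ≤ x) (hx : x < 1)
    (hinf : ∀ k, ∃ m, k < m ∧ digit b x m ≠ 0) :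
    IsSumApproxBelow b x fun i => (digit b x (digitPos b x i) : ℚ) / (b : ℚ) ^ digitPos b x i := by
  refine ⟨by simp [digitPos_zero, digit, Nat.floor_eq_zero.2 hx],
    fun i => digit b x (digitPos b x i), digitPos b x, fun i hi => ⟨?_, ?_⟩, fun i hi => ⟨?_, ?_⟩,
    fun i _ => rfl, ?_⟩
  · obtain ⟨j, rfl⟩ := Nat.exists_eq_add_of_le' hi
    exact Nat.one_le_iff_ne_zero.2 (digit_digitPos_ne_zero hinf j)
  · exact Nat.le_sub_one_of_lt (Nat.mod_lt _ (by omega))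
  · exact hi.trans (digitPos_strictMono hinf).le_apply
  · exact digitPos_strictMono hinf (Nat.lt_succ_self i)
  · have hb1 : (1 : ℝ) < b := by exact_mod_cast hb
    rw [hasSum_iff_tendsto_nat_of_nonneg fun i => by positivity,
      ← Filter.tendsto_add_atTop_iff_nat 1]
    have h1 : Filter.Tendsto (fun k : ℕ => (⌊(b : ℝ) ^ k * x⌋₊ : ℝ) / (b : ℝ) ^ k) Filter.atTop
        (nhds x) := by
      have := (tendsto_nat_floor_mul_div_atTop h0).comp
        (tendsto_pow_atTop_atTop_of_one_lt hb1)
      refine this.congr fun k => ?_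
      simp [mul_comm]
    refine (h1.comp (digitPos_strictMono hinf).tendsto_atTop).congr fun i => ?_
    rw [Function.comp_apply, ← sum_digit_digitPos hb hx hinf]
    push_cast
    rfl

end DigitPos

/-- The remainder of `x` after the first terms of a sum approximation determines the next term:
the terms after the `i`-th sum up to a positive number that is at most `b ^ (-k i)`. -/
theorem remainder_mem_Ioc {b : ℕ} (hb : 2 ≤ b) {x : ℝ} {A : ℕ → ℚ} {D k : ℕ → ℕ}
    (hD : ∀ i, 1 ≤ i → 1 ≤ D i ∧ D i ≤ b - 1) (hk : ∀ i, 1 ≤ i → 1 ≤ k i ∧ k i < k (i + 1))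
    (hA : ∀ i, 1 ≤ i → A i = (D i : ℚ) / (b : ℚ) ^ k i) (hsum : HasSum (fun i => (A i : ℝ)) x)
    {i : ℕ} (hi : 1 ≤ i) :
    x - ∑ j ∈ Finset.range i, (A j : ℝ) ∈
      Set.Ioc ((D i : ℝ) / (b : ℝ) ^ k i) (((D i : ℝ) + 1) / (b : ℝ) ^ k i) := by
  have hb1 : (1 : ℝ) < b := by exact_mod_cast hb
  have hb0 : (0 : ℝ) < b := by linarith
  have hA' : ∀ j, 1 ≤ j → (A j : ℝ) = (D j : ℝ) / (b : ℝ) ^ k j := fun j hj => by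
    rw [hA j hj]
    push_cast
    rfl
  have htail := (hasSum_nat_add_iff' (i + 1)).2 hsum
  rw [Finset.sum_range_succ, ← sub_sub, hA' i hi] at htail
  have hpos : ∀ j, 1 ≤ j → 0 < (A j : ℝ) := fun j hj => by
    rw [hA' j hj]
    have : (0 : ℝ) < D j := by exact_mod_cast (hD j hj).1
    positivity
  have h1 := sum_le_hasSum {0} (fun j _ => (hpos (j + (i + 1)) (by omega)).le) htail
  rw [Finset.sum_singleton] at h1
  have h2 := hpos (0 + (i + 1)) (by omega)
  have hkle : ∀ j, k i + 1 + j ≤ k (j + (i + 1)) := by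
    intro j
    induction j with
    | zero =>
      have := (hk i hi).2
      simpa using this
    | succ j ih =>
      have := (hk (j + (i + 1)) (by omega)).2
      rw [show j + 1 + (i + 1) = j + (i + 1) + 1 by ring]
      omega
  have hgeo : HasSum (fun j : ℕ => ((b : ℝ) - 1) / b ^ (k i + 1) * (1 / (b : ℝ)) ^ j)
      (((b : ℝ) - 1) / b ^ (k i + 1) * (1 - 1 / (b : ℝ))⁻¹) :=
    (hasSum_geometric_of_lt_one (by positivity) (by rw [div_lt_one hb0]; exact hb1)).mul_left _
  have hval : ((b : ℝ) - 1) / b ^ (k i + 1) * (1 - 1 / (b : ℝ))⁻¹ = 1 / b ^ k i := by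
    have : (b : ℝ) - 1 ≠ 0 := by linarith
    rw [one_sub_div hb0.ne', pow_succ]
    field_simp
  rw [hval] at hgeo
  have h3 := hasSum_le (fun j => ?_) htail hgeo
  · rw [Set.mem_Ioc, add_div]
    constructor <;> linarith
  · rw [hA' _ (by omega), one_div_pow, div_mul_div_comm, mul_one, ← pow_add]
    have h4 : (D (j + (i + 1)) : ℝ) ≤ b - 1 := by
      have := (hD (j + (i + 1)) (by omega)).2
      have h5 : D (j + (i + 1)) + 1 ≤ b := by omega
      have h6 : (D (j + (i + 1)) : ℝ) + 1 ≤ b := by exact_mod_cast h5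
      linarith
    exact div_le_div₀ (by linarith) h4 (by positivity) (pow_le_pow_right₀ hb1.le (hkle j))

/-- The scale `k` of a nonzero digit `D < b` is determined by any number in
`(D * b ^ (-k), (D + 1) * b ^ (-k)]`. -/
theorem scale_le_of_mem_Ioc {b : ℕ} (hb : 2 ≤ b) {r : ℝ} {D D' k k' : ℕ} (hD : 1 ≤ D)
    (hD' : D' ≤ b - 1) (h1 : (D : ℝ) / (b : ℝ) ^ k < r) (h2 : r ≤ ((D' : ℝ) + 1) / (b : ℝ) ^ k') :
    k' ≤ k := by
  by_contra! hlt
  have hb1 : (1 : ℝ) < b := by exact_mod_cast hb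
  have hb0 : (0 : ℝ) < b := by linarith
  have h3 : (D' : ℝ) + 1 ≤ b := by exact_mod_cast (by omega : D' + 1 ≤ b)
  have h4 : (1 : ℝ) ≤ D := by exact_mod_cast hD
  have h5 : (b : ℝ) ^ k * b ≤ b ^ k' := by
    rw [← pow_succ]
    exact pow_le_pow_right₀ hb1.le hlt
  have h6 : ((D' : ℝ) + 1) / (b : ℝ) ^ k' ≤ (D : ℝ) / (b : ℝ) ^ k := by
    rw [div_le_div_iff₀ (by positivity) (by positivity)]
    have h7 : (0 : ℝ) < b ^ k := by positivity
    calc ((D' : ℝ) + 1) * b ^ k ≤ b * b ^ k := mul_le_mul_of_nonneg_right h3 h7.le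
      _ = b ^ k * b := mul_comm _ _
      _ ≤ b ^ k' := h5
      _ ≤ D * b ^ k' := le_mul_of_one_le_left (by positivity) h4
  linarith

theorem IsSumApproxBelow.unique {b : ℕ} (hb : 2 ≤ b) {x : ℝ} {A A' : ℕ → ℚ}
    (hA : IsSumApproxBelow b x A) (hA' : IsSumApproxBelow b x A') : A' = A := by
  obtain ⟨h0, D, k, hD, hk, hAD, hsum⟩ := hA
  obtain ⟨h0', D', k', hD', hk', hAD', hsum'⟩ := hA'
  funext i
  induction i using Nat.strong_induction_on with
  | _ i ih =>
    rcases Nat.eq_zero_or_pos i with rfl | hi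
    · rw [h0, h0']
    · have h1 := remainder_mem_Ioc hb hD hk hAD hsum hi
      have h2 := remainder_mem_Ioc hb hD' hk' hAD' hsum' hi
      rw [Finset.sum_congr rfl fun j hj => by rw [ih j (Finset.mem_range.1 hj)]] at h2
      have hkk : k i = k' i := le_antisymm
        (scale_le_of_mem_Ioc hb (hD' i hi).1 (hD i hi).2 h2.1 h1.2)
        (scale_le_of_mem_Ioc hb (hD i hi).1 (hD' i hi).2 h1.1 h2.2)
      have hb0 : (0 : ℝ) < (b : ℝ) ^ k' i := by positivity
      rw [hkk] at h1
      have h3 := (div_lt_div_iff_of_pos_right hb0).1 (h1.1.trans_le h2.2)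
      have h4 := (div_lt_div_iff_of_pos_right hb0).1 (h2.1.trans_le h1.2)
      have h5 : D i < D' i + 1 := by exact_mod_cast h3
      have h6 : D' i < D i + 1 := by exact_mod_cast h4
      rw [hAD i hi, hAD' i hi, hkk, show D i = D' i by omega]

/-! ### The positions of the nonzero digits of `α` -/

/-- The digits of `α` after position `k` follow the expansion of a partial sum with denominator
`denom f (n + 1) ≤ 2 ^ h f n ^ 3`, so they cannot vanish for long. -/
theorem Honest.exists_digit_ne_zero {f : ℕ → ℕ} (hf : Honest f) {b k n : ℕ} (hb : 2 ≤ b)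
    (hbn : b ≤ n) (hn : 1 + k * b + h f n ^ 3 < h f (n + 1)) :
    ∃ m, k < m ∧ m ≤ k + h f n ^ 3 ∧ digit b (alpha f) m ≠ 0 := by
  by_contra! hcon
  have hP : ¬ P n ∣ b := fun hd => by
    have h1 := Nat.le_of_dvd (by omega) hd
    have h2 := lt_P n
    omega
  have h1 := hf.floor_add_le hP (hf.two_mul_pow_mul_denom_lt hn)
  have h2 := Nat.lt_floor_add_one ((b : ℝ) ^ (k + h f n ^ 3) * alpha f)
  rw [floor_pow_add_of_digit_eq_zero hb hcon] at h2
  have hD : (0 : ℝ) < denom f (n + 1) := by exact_mod_cast denom_pos f (n + 1)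
  have hDle : (denom f (n + 1) : ℝ) ≤ b ^ h f n ^ 3 := by
    exact_mod_cast (hf.denom_succ_le n).trans (Nat.pow_le_pow_left hb _)
  have h3 := mul_le_mul_of_nonneg_left h1 (by positivity : (0 : ℝ) ≤ (b : ℝ) ^ h f n ^ 3)
  have h4 : (1 : ℝ) ≤ (b : ℝ) ^ h f n ^ 3 * (1 / denom f (n + 1)) := by
    rw [mul_one_div, one_le_div hD]
    exact hDle
  push_cast at h2
  rw [pow_add, mul_comm ((b : ℝ) ^ k), mul_assoc] at h2
  rw [mul_add] at h3
  linarith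

/-- For every position `k` there is a partial sum to which `exists_digit_ne_zero` applies. -/
theorem Honest.exists_lt_h_succ {f : ℕ → ℕ} (hf : Honest f) (b k : ℕ) :
    ∃ n, b ≤ n ∧ 1 + k * b + h f n ^ 3 < h f (n + 1) := by
  refine ⟨max b (k * b), le_max_left _ _, ?_⟩
  have h1 := hf.lt_h (max b (k * b))
  have h2 := le_max_right b (k * b)
  have h3 := hf.four_mul_h_pow_lt (max b (k * b))
  have h4 : h f (max b (k * b)) ≤ h f (max b (k * b)) ^ 3 := Nat.le_self_pow (by norm_num) _
  omega

theorem Honest.exists_gt_digit_ne_zero {f : ℕ → ℕ} (hf : Honest f) {b : ℕ} (hb : 2 ≤ b) (k : ℕ) :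
    ∃ m, k < m ∧ digit b (alpha f) m ≠ 0 := by
  obtain ⟨n, hbn, hn⟩ := hf.exists_lt_h_succ b k
  obtain ⟨m, hm, -, hd⟩ := hf.exists_digit_ne_zero hb hbn hn
  exact ⟨m, hm, hd⟩

/-- As long as the terms of the series from index `n + 1` on do not affect the digits, the gaps
between nonzero digits are at most `h f n ^ 3`. -/
theorem Honest.digitPos_le_mul {f : ℕ → ℕ} (hf : Honest f) {b n : ℕ} (hb : 2 ≤ b) (hbn : b ≤ n)
    {i : ℕ} (hi : ∀ j < i, 1 + digitPos b (alpha f) j * b + h f n ^ 3 < h f (n + 1)) :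
    digitPos b (alpha f) i ≤ i * h f n ^ 3 := by
  have hinf := hf.exists_gt_digit_ne_zero hb
  induction i with
  | zero => simp [digitPos_zero]
  | succ i ih =>
    obtain ⟨m, hm, hle, hd⟩ := hf.exists_digit_ne_zero hb hbn (hi i (Nat.lt_succ_self i))
    have h1 := ih fun j hj => hi j (hj.trans (Nat.lt_succ_self i))
    have h2 := digitPos_succ_le hinf hm hd
    rw [add_mul, one_mul]
    omega

/-- Before the term of index `n + 1` can affect the digits, so many nonzero digits have been passed
that its exponent is polynomially bounded by their number: gaps of length at most `h f n ^ 3` have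
covered a distance of order `h f (n + 1) ≥ 2 ^ (4 * h f n ^ 3)`. -/
theorem Honest.h_succ_le_sq {f : ℕ → ℕ} (hf : Honest f) {b n : ℕ} (hb : 2 ≤ b) (hbn : b ≤ n)
    {i : ℕ} (hi : h f (n + 1) ≤ 1 + digitPos b (alpha f) i * b + h f n ^ 3) :
    h f (n + 1) ≤ (i * b + 2) ^ 2 := by
  classical
  -- It suffices to consider the first index for which the hypothesis holds.
  have hex : ∃ i, h f (n + 1) ≤ 1 + digitPos b (alpha f) i * b + h f n ^ 3 := ⟨i, hi⟩
  have hle : Nat.find hex ≤ i := Nat.find_min' hex hi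
  have h1 := Nat.find_spec hex
  have h2 := hf.digitPos_le_mul hb hbn fun j hj => not_le.1 (Nat.find_min hex hj)
  generalize Nat.find hex = i₀ at hle h1 h2
  have h3 := hf.two_pow_le_h_succ n
  have h4 : 1 ≤ h f n ^ 3 := Nat.one_le_pow _ _ (by have := hf.lt_h n; omega)
  generalize h f n ^ 3 = X at *
  generalize h f (n + 1) = H at *
  generalize digitPos b (alpha f) i₀ = k at *
  have h5 : H ≤ (i₀ * b + 2) * X := by
    have : k * b ≤ i₀ * X * b := Nat.mul_le_mul_right _ h2
    nlinarith
  have h6 : X ^ 2 ≤ H := by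
    calc X ^ 2 ≤ (2 ^ X) ^ 2 := Nat.pow_le_pow_left Nat.lt_two_pow_self.le _
      _ = 2 ^ (X * 2) := (pow_mul _ _ _).symm
      _ ≤ 2 ^ (4 * X) := Nat.pow_le_pow_right (by norm_num) (by omega)
      _ ≤ H := h3
  have h7 : H * H ≤ (i₀ * b + 2) ^ 2 * H := by
    calc H * H ≤ ((i₀ * b + 2) * X) * ((i₀ * b + 2) * X) := Nat.mul_le_mul h5 h5
      _ = (i₀ * b + 2) ^ 2 * X ^ 2 := by ring
      _ ≤ (i₀ * b + 2) ^ 2 * H := Nat.mul_le_mul_left _ h6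
  have hH : 0 < H := by nlinarith
  exact (Nat.le_of_mul_le_mul_right h7 hH).trans
    (Nat.pow_le_pow_left (by have := Nat.mul_le_mul_right b hle; omega) 2)

/-- The position of the `i`-th nonzero digit of `α` is polynomially bounded in `i`. -/
theorem Honest.digitPos_le {f : ℕ → ℕ} (hf : Honest f) {b : ℕ} (hb : 2 ≤ b) (i : ℕ) :
    digitPos b (alpha f) i ≤ i * (h f b ^ 3 + (i * b + 2) ^ 6) := by
  classical
  have hmono := (digitPos_strictMono (hf.exists_gt_digit_ne_zero hb)).monotone
  have hex := hf.exists_lt_h_succ b (digitPos b (alpha f) i)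
  obtain ⟨hbn, hn⟩ := Nat.find_spec hex
  have hmin : ∀ {m}, m < Nat.find hex → _ := fun {m} hm => Nat.find_min hex hm
  generalize Nat.find hex = n at hbn hn hmin
  have h1 : digitPos b (alpha f) i ≤ i * h f n ^ 3 := by
    refine hf.digitPos_le_mul hb hbn fun j hj => lt_of_le_of_lt ?_ hn
    have := Nat.mul_le_mul_right b (hmono hj.le)
    omega
  refine h1.trans (Nat.mul_le_mul_left i ?_)
  rcases hbn.eq_or_lt with rfl | hlt
  · exact Nat.le_add_right _ _
  · obtain ⟨m, rfl⟩ : ∃ m, n = m + 1 := ⟨n - 1, by omega⟩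
    have hbm : b ≤ m := Nat.lt_succ_iff.1 hlt
    have h2 := hf.h_succ_le_sq hb hbm
      (not_lt.1 fun hc => hmin (Nat.lt_succ_self m) ⟨hbm, hc⟩)
    calc h f (m + 1) ^ 3 ≤ ((i * b + 2) ^ 2) ^ 3 := Nat.pow_le_pow_left h2 3
      _ = (i * b + 2) ^ 6 := by rw [← pow_mul]
      _ ≤ _ := Nat.le_add_left _ _

theorem Honest.alpha_lt_one {f : ℕ → ℕ} (hf : Honest f) : alpha f < 1 := by
  have h1 := hf.alpha_le 0
  have h2 : 2 ≤ h f 0 := by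
    have : g 0 < h f 0 := g_strictMono (by have := hf.pos 0; omega)
    rwa [g] at this
  have h3 : (2 : ℝ) ^ 2 ≤ 2 ^ h f 0 := pow_le_pow_right₀ (by norm_num) h2
  have h4 : (2 : ℝ) / 2 ^ h f 0 ≤ 2 / 2 ^ 2 :=
    div_le_div_of_nonneg_left (by norm_num) (by norm_num) h3
  norm_num [numer] at h1 h4
  linarith

theorem alpha_nonneg (f : ℕ → ℕ) : 0 ≤ alpha f :=
  (hasSum_alpha f).nonneg fun i => by positivity

theorem Honest.elementary_digit {f : ℕ → ℕ} (hf : Honest f) (b : ℕ) {n : ℕ}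
    {a : (Fin n → ℕ) → ℕ} (ha : Elementary a) : Elementary fun v => digit b (alpha f) (a v) :=
  (hf.elementary_floor b ha).mod (.const b)

theorem Honest.elementary_digitPos {f : ℕ → ℕ} (hf : Honest f) {b : ℕ} (hb : 2 ≤ b) :
    Elementary fun v : Fin 1 → ℕ => digitPos b (alpha f) (v 0) :=
  Elementary.nth (B := fun i => i * (h f b ^ 3 + (i * b + 2) ^ 6))
    (.of_iff (.imp (.not (.eq (.proj 0) (.const 0)))
      (.not (.eq (hf.elementary_digit b (.proj 0)) (.const 0)))) fun _ => or_iff_not_imp_left.symm)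
    (infinite_digit (hf.exists_gt_digit_ne_zero hb))
    (.mul (.proj 0) (.add (.const _) (.pow (.add (.mul (.proj 0) (.const b)) (.const 2))
      (.const 6)))) (hf.digitPos_le hb) (.proj 0)

end SumApprox

theorem mainTheorem5 (f : ℕ → ℕ) (hf : SumApprox.Honest f) (b : ℕ) (hb : 2 ≤ b) :
    ∃ A : ℕ → ℚ,
      SumApprox.IsSumApproxBelow b (SumApprox.alpha f) A ∧
      (∀ A' : ℕ → ℚ, SumApprox.IsSumApproxBelow b (SumApprox.alpha f) A' → A' = A) ∧
      SumApprox.ElementaryRat A := by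
  have hA := SumApprox.isSumApproxBelow_digit hb (SumApprox.alpha_nonneg f) hf.alpha_lt_one
    (hf.exists_gt_digit_ne_zero hb)
  refine ⟨_, hA, fun A' hA' => hA.unique hb hA', ?_⟩
  have hpos := hf.elementary_digitPos hb
  have hq := SumApprox.ElementaryRat.div
    (N := fun i => SumApprox.digit b (SumApprox.alpha f)
      (SumApprox.digitPos b (SumApprox.alpha f) i))
    (M := fun i => b ^ SumApprox.digitPos b (SumApprox.alpha f) i)
    (hf.elementary_digit b hpos) (.pow (.const b) hpos) fun i => by positivity
  simpa using hq
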